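/- For an integer $d\ge 2$ and $\beta>0$, a function $f:\mathbb R^d\to\mathbb R$ is called piecewise constant, $f\in PC(d,\beta)$, if there is a set $B\subseteq[0,1]^d$ such that (i) for every $x\in[0,1]^d\setminus B$ there is $\varepsilon>0$ with $f(y)=f(x)$ for all $y$ with $\|y-x\|<\varepsilon$, and (ii) for every $0<r\le 1$ the set $B$ can be covered by at most $\beta r^{-(d-1)}$ closed Euclidean balls of radius $r$. Let $D_d$ be the edge-vertex incidence matrix of the $d$-dimensional grid graph on $[N]^d$, so that the entries of $D_d\theta$ are the differences $\theta_{\mathbf i+\mathbf e_j}-\theta_{\mathbf i}$ ($1\le j\le d$, $\mathbf i\in[N]^d$, $i_j<N$). Put $x_{\mathbf i}=\mathbf i/N$ for $\mathbf i\in[N]^d$, $\|g\|_n^2=\frac1n\sum_{\mathbf i\in[N]^d}g(x_{\mathbf i})^2$, $r_2(n)=\log n$ and $r_d(n)=1$ for $d\ge3$. Proposition. For every $d\ge2$ there are constants $c,C>0$ depending only on $d$ such that the following holds for all $N\ge1$, $n=N^d$, $\delta\in(0,1)$, $\sigma\ge0$, $\beta>0$ and $f^*\in PC(d,\beta)$.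 Let $y_{\mathbf i}=f^*(x_{\mathbf i})+\varepsilon_{\mathbf i}$, $\mathbf i\in[N]^d$, with $\varepsilon\sim\mathcal N(0,\sigma^2I_n)$, and let $$\hat\theta\in\operatorname*{argmin}_{\theta\in\mathbb R^n}\ \frac1n\|\theta-y\|_2^2+\lambda\|D_d\theta\|_1,\qquad \lambda=\frac{c\,\sigma\sqrt{r_d(n)\log(en/\delta)}}{n},$$ be the total variation denoiser. Let $\hat f$ be any function with $\hat f(x_{\mathbf i})=\hat\theta_{\mathbf i}$ for all $\mathbf i\in[N]^d$ (arbitrary elsewhere). Then, with probability at least $1-2\delta$, $$\|\hat f-f^*\|_n^2\le C\Big(\frac{\sigma^2\beta}{n^{1/d}}\,r_d(n)\log\frac{en}{\delta}+\frac{\sigma^2}{n}\log\frac e\delta\Big).$$ In particular the bound is scale-free: it does not depend on the sizes of the jumps of $f^*$. -/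

import Mathlib

open MeasureTheory ProbabilityTheory
open scoped NNReal ENNReal Matrix

noncomputable section

/-- The vertex set `[N]^d` of the `d`-dimensional grid (each coordinate is indexed from `0`). -/
abbrev GridVertex (d N : ℕ) : Type := Fin d → Fin N

/-- The edges of the `d`-dimensional grid: a direction `j` together with a vertex `i` that is not
the last one in direction `j`; the edge joins `i` to `i + e_j`. -/
abbrev GridEdge (d N : ℕ) : Type := Σ j : Fin d, {i : GridVertex d N // (i j : ℕ) + 1 < N}

/-- The lower endpoint `i` of an edge. -/
def GridEdge.lower {d N : ℕ} (e : GridEdge d N) : GridVertex d N := e.2.1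

/-- The upper endpoint `i + e_j` of an edge. -/
def GridEdge.upper {d N : ℕ} (e : GridEdge d N) : GridVertex d N :=
  Function.update e.2.1 e.1 ⟨(e.2.1 e.1 : ℕ) + 1, e.2.2⟩

/-- The edge-vertex incidence matrix `D_d` of the grid, so that `(D_d θ)_e = θ_{i + e_j} - θ_i`;
its block of rows of direction `j` is `I ⊗ ⋯ ⊗ D₁ ⊗ ⋯ ⊗ I`. -/
def gridIncidence (d N : ℕ) : Matrix (GridEdge d N) (GridVertex d N) ℝ :=
  Matrix.of fun e v => if v = e.upper then 1 else if v = e.lower then -1 else 0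

/-- The objective `(1/n) ‖θ - y‖₂² + λ ‖D θ‖₁` of total variation denoising, `n = |V|`. -/
def tvObjective {E V : Type*} [Fintype E] [Fintype V] (D : Matrix E V ℝ) (lam : ℝ) (y θ : V → ℝ) :
    ℝ :=
  (1 / (Fintype.card V : ℝ)) * ∑ v, (θ v - y v) ^ 2 + lam * ∑ e, |(D *ᵥ θ) e|

/-- `θ` is a total variation denoiser of `y`: a global minimizer of the objective. -/
def IsTVDenoiser {E V : Type*} [Fintype E] [Fintype V] (D : Matrix E V ℝ) (lam : ℝ)
    (y θ : V → ℝ) : Prop :=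
  ∀ θ' : V → ℝ, tvObjective D lam y θ ≤ tvObjective D lam y θ'

/-- The grid point `x_i = i / N`, with `i ∈ {1, …, N}^d`. -/
def gridPoint {d N : ℕ} (i : GridVertex d N) : EuclideanSpace ℝ (Fin d) :=
  WithLp.toLp 2 fun k => ((i k : ℕ) + 1 : ℝ) / (N : ℝ)

/-- The squared empirical norm `‖g‖_n² = (1/n) ∑ g(x_i)²`, `n = N^d`. -/
def empiricalNormSq (d N : ℕ) (g : EuclideanSpace ℝ (Fin d) → ℝ) : ℝ :=
  (1 / (N : ℝ) ^ d) * ∑ i : GridVertex d N, g (gridPoint i) ^ 2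

/-- The unit cube `[0,1]^d`. -/
def unitCube (d : ℕ) : Set (EuclideanSpace ℝ (Fin d)) := {x | ∀ k, 0 ≤ x k ∧ x k ≤ 1}

/-- The class `PC(d, β)` of piecewise constant functions: `f` is locally constant on the unit cube
off a boundary set `B`, and for every `0 < r ≤ 1` the set `B` is covered by at most `β r^{-(d-1)}`
closed Euclidean balls of radius `r` (with centres anywhere in the space). -/
def IsPiecewiseConstant (d : ℕ) (β : ℝ) (f : EuclideanSpace ℝ (Fin d) → ℝ) : Prop :=
  ∃ B : Set (EuclideanSpace ℝ (Fin d)), B ⊆ unitCube d ∧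
    (∀ x ∈ unitCube d \ B, ∃ ε : ℝ, 0 < ε ∧ ∀ y, ‖y - x‖ < ε → f x = f y) ∧
    ∀ r : ℝ≥0, 0 < r → r ≤ 1 →
      (Metric.externalCoveringNumber r B : ℝ≥0∞) ≤ ENNReal.ofReal (β / (r : ℝ) ^ (d - 1))

/-- The factor `r_d(n)`: `log n` for `d = 2` and `1` for `d ≥ 3`. -/
def rateFactor (d n : ℕ) : ℝ := if d = 2 then Real.log n else 1

/-- The law `𝒩(0, σ² I)` on `ℝ^V`: independent centred Gaussian coordinates of variance `σ²`. -/
def gaussianNoise (V : Type*) [Fintype V] (σ : ℝ) : Measure (V → ℝ) :=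
  Measure.pi fun _ => gaussianReal 0 (Real.toNNReal (σ ^ 2))

end

/-! Let `h` be the estimation error, `z` the noise and `D` the incidence matrix. The noise enters
through `⟨h, z⟩`, which is to be absorbed by the penalty `λ‖Dh‖₁`. For this `h` is recovered from
`Dh`: transport the uniform distribution on the grid to the point mass at `v` through nested boxes
of sides `L = 1, …, N`. The resulting flow gives `h v = mean + ∑ e, gridFlow e v * (Dh) e`
(`eq_mean_add_sum_gridFlow`), an explicit substitute for the pseudo-inverse of `D`. Growing the box
from `L` to `L + 1` uses flow at most `L^{-d}`, on edges within distance `L`, so for each edge the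
squared flow summed over `v` is of order `∑ L^{1-d}`: logarithmic for `d = 2`, bounded for `d ≥ 3`
(`sum_sq_gridFlow_le`). This is the source of `r_d(n)`.

On the Gaussian event where `λ` dominates all the forms `∑ v, gridFlow e v * z v`, minimality leaves
only the part of `‖Dh‖₁` on the set `S` of edges where the truth jumps. Cauchy–Schwarz and `‖D‖² ≤
4d` bound that part by `√(4d|S|) ‖h‖`, so only the number of jumps matters, never their size.
Covering the boundary set by balls of radius `1/N`, each near boundedly many edges, gives `|S| ≲ β
N^{d-1}` (`card_jump_edges_le`). -/

/-! ### Uniform distributions on windows of an interval. -/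

/-- The cumulative distribution function (strictly below `t`) of the uniform distribution on the
window of `L` consecutive points of `{0, …, N - 1}` that starts at `v` or, if that sticks out, ends
at `N - 1`. -/
noncomputable def windowCdf (N L v t : ℕ) : ℝ := (min (t - min v (N - L)) L : ℕ) / (L : ℝ)

/-- The uniform distribution on the window of length `L` around `v`. -/
noncomputable def windowMass (N L v t : ℕ) : ℝ := windowCdf N L v (t + 1) - windowCdf N L v t

theorem windowCdf_zero (N L v : ℕ) : windowCdf N L v 0 = 0 := by simp [windowCdf]

theorem windowCdf_last {N L v : ℕ} (hL : 1 ≤ L) (hLN : L ≤ N) : windowCdf N L v N = 1 := by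
  have h : min (N - min v (N - L)) L = L := by omega
  rw [windowCdf, h, div_self]
  positivity

theorem windowMass_eq (N L v t : ℕ) :
    windowMass N L v t =
      if min v (N - L) ≤ t ∧ t < min v (N - L) + L then 1 / (L : ℝ) else 0 := by
  unfold windowMass windowCdf
  set s := min v (N - L)
  rw [← sub_div]
  split_ifs with h
  · have h1 : min (t + 1 - s) L = min (t - s) L + 1 := by omega
    rw [h1]; push_cast; ring
  · have h1 : min (t + 1 - s) L = min (t - s) L := by omega
    rw [h1]; simp

theorem windowMass_nonneg (N L v t : ℕ) : 0 ≤ windowMass N L v t := by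
  rw [windowMass_eq]; split_ifs <;> positivity

theorem windowMass_le (N L v t : ℕ) : windowMass N L v t ≤ 1 / (L : ℝ) := by
  rw [windowMass_eq]; split_ifs
  · exact le_rfl
  · positivity

theorem near_of_windowMass_ne_zero {N L v t : ℕ} (hv : v < N) (hLN : L ≤ N)
    (h : windowMass N L v t ≠ 0) : v < t + L ∧ t < v + L := by
  rw [windowMass_eq] at h
  split_ifs at h with h1
  · omega
  · exact absurd rfl h

theorem windowMass_one {N v t : ℕ} (hv : v < N) :
    windowMass N 1 v t = if t = v then 1 else 0 := by
  rw [windowMass_eq]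
  have : (min v (N - 1) ≤ t ∧ t < min v (N - 1) + 1) ↔ t = v := by omega
  simp only [this]; simp

theorem windowMass_full {N v t : ℕ} (ht : t < N) : windowMass N N v t = 1 / (N : ℝ) := by
  rw [windowMass_eq, if_pos]; omega

/-- The window of length `L` lies inside the one of length `L + 1`, so the numbers `b` and `a` of
their points below `t` satisfy `b ≤ a ≤ b + 1`. -/
theorem abs_windowCdf_succ_sub_le {N L v t : ℕ} (hL : 1 ≤ L) (hLN : L + 1 ≤ N) :
    |windowCdf N (L + 1) v t - windowCdf N L v t| ≤ 1 / (L : ℝ) := by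
  unfold windowCdf
  have hL0 : (0 : ℝ) < L := by exact_mod_cast hL
  obtain ⟨a, ha⟩ : ∃ a, a = min (t - min v (N - (L + 1))) (L + 1) := ⟨_, rfl⟩
  obtain ⟨b, hb⟩ : ∃ b, b = min (t - min v (N - L)) L := ⟨_, rfl⟩
  rw [← ha, ← hb]
  have h1 : a ≤ b + 1 := by omega
  have h2 : b ≤ a := by omega
  have h3 : b ≤ L := by omega
  have h1' : (a : ℝ) ≤ b + 1 := by exact_mod_cast h1
  have h2' : (b : ℝ) ≤ a := by exact_mod_cast h2
  have h3' : (b : ℝ) ≤ L := by exact_mod_cast h3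
  push_cast
  rw [div_sub_div _ _ (by positivity) (by positivity), abs_div, abs_of_pos (a := ((L : ℝ) + 1) * L)
    (by positivity), div_le_div_iff₀ (by positivity) (by positivity), one_mul]
  gcongr
  rw [abs_le]
  constructor <;> nlinarith

/-- To the left of the longer window both functions are `0`, to its right both are `1`. -/
theorem near_of_windowCdf_succ_sub_ne_zero {N L v t : ℕ} (hv : v < N) (hL : 1 ≤ L)
    (hLN : L + 1 ≤ N) (h : windowCdf N (L + 1) v (t + 1) - windowCdf N L v (t + 1) ≠ 0) :
    v ≤ t + L ∧ t ≤ v + L := by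
  by_contra hc
  apply h
  unfold windowCdf
  have hL0 : (0 : ℝ) < L := by exact_mod_cast hL
  by_cases h1 : t + 1 ≤ min v (N - (L + 1))
  · have e1 : min (t + 1 - min v (N - (L + 1))) (L + 1) = 0 := by omega
    have e2 : min (t + 1 - min v (N - L)) L = 0 := by omega
    rw [e1, e2]; simp
  · have e1 : min (t + 1 - min v (N - (L + 1))) (L + 1) = L + 1 := by omega
    have e2 : min (t + 1 - min v (N - L)) L = L := by omega
    rw [e1, e2, div_self (by positivity), div_self (by positivity), sub_self]

/-! ### The flow representation of functions on the grid. -/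

/-- Summation by parts along the direction `j` of the grid. -/
theorem sum_grid_by_parts {d N : ℕ} (j : Fin d) (G : ℕ → ℝ) (hG0 : G 0 = 0) (hGN : G N = 0)
    (R θ : GridVertex d N → ℝ)
    (hR : ∀ (w : GridVertex d N) (a : Fin N), R (Function.update w j a) = R w) :
    ∑ i : {i : GridVertex d N // (i j : ℕ) + 1 < N}, G ((i.1 j : ℕ) + 1) * R i.1 *
        (θ (GridEdge.upper ⟨j, i⟩) - θ i.1)
      = ∑ w : GridVertex d N, (G (w j) - G ((w j : ℕ) + 1)) * R w * θ w := by
  simp only [mul_sub, sub_mul, Finset.sum_sub_distrib]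
  congr 1
  -- Edges are reindexed by their upper endpoints; the vertices missed have `w j = 0`, where `G`
  -- vanishes.
  · rw [← Finset.sum_subset (Finset.subset_univ
      (Finset.univ.filter fun w : GridVertex d N => 0 < (w j : ℕ)))]
    · refine Finset.sum_bij' (fun i _ => GridEdge.upper ⟨j, i⟩)
        (fun w hw => ⟨Function.update w j ⟨(w j : ℕ) - 1, by omega⟩, by
          have := (w j).2
          simp at hw ⊢; omega⟩) ?_ ?_ ?_ ?_ ?_
      · intro i _; simp [GridEdge.upper]
      · intro w hw; simp
      · intro i _; ext1; simp [GridEdge.upper]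
      · intro w hw
        simp only [Finset.mem_filter, Finset.mem_univ, true_and] at hw
        simp only [GridEdge.upper, Function.update_self, Function.update_idem]
        convert Function.update_eq_self j w using 2
        ext; simp; omega
      · intro i _
        simp [GridEdge.upper, hR]
    · intro w _ hw
      have : (w j : ℕ) = 0 := by simpa using hw
      simp [this, hG0]
  · rw [← Finset.sum_subset (Finset.subset_univ
      (Finset.univ.filter fun w : GridVertex d N => (w j : ℕ) + 1 < N))]
    · exact (Finset.sum_subtype _ (by simp) (fun w => G ((w j : ℕ) + 1) * R w * θ w)).symm
    · intro w _ hw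
      have : (w j : ℕ) + 1 = N := by
        have := (w j).2
        simp at hw; omega
      simp [this, hGN]

theorem GridEdge.upper_ne_lower {d N : ℕ} (e : GridEdge d N) : e.upper ≠ e.lower := by
  intro h
  have := congrArg (fun f => ((f e.1 : Fin N) : ℕ)) h
  simp [GridEdge.upper, GridEdge.lower] at this

theorem gridIncidence_mulVec {d N : ℕ} (θ : GridVertex d N → ℝ) (e : GridEdge d N) :
    (gridIncidence d N *ᵥ θ) e = θ e.upper - θ e.lower := by
  have h : ∀ v, gridIncidence d N e v * θ v
      = (if v = e.upper then θ v else 0) - (if v = e.lower then θ v else 0) := by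
    intro v
    have := e.upper_ne_lower
    simp only [gridIncidence, Matrix.of_apply]
    by_cases h1 : v = e.upper
    · subst h1; simp [this]
    · by_cases h2 : v = e.lower <;> simp [h1, h2, this.symm]
  simp [Matrix.mulVec, dotProduct, h, Finset.sum_sub_distrib]

/-- The side lengths of a box on its way from the cube of side `L` to the cube of side `L + 1`: the
first `k` sides have been extended. -/
def stepSide (L k l : ℕ) : ℕ := if l < k then L + 1 else L

/-- The mean of `θ` over the box around `v` with side lengths `stepSide L k`. -/
noncomputable def boxMean {d N : ℕ} (L k : ℕ) (θ : GridVertex d N → ℝ) (v : GridVertex d N) : ℝ :=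
  ∑ w : GridVertex d N, (∏ l : Fin d, windowMass N (stepSide L k l) (v l) (w l)) * θ w

/-- The flow through the edge `(j, i)` that transports the uniform distribution on the box of sides
`stepSide L j` around `v` to the uniform distribution on the box of sides `stepSide L (j + 1)`. -/
noncomputable def stepFlow {d N : ℕ} (L : ℕ) (j : Fin d) (v i : GridVertex d N) : ℝ :=
  (windowCdf N (L + 1) (v j) ((i j : ℕ) + 1) - windowCdf N L (v j) ((i j : ℕ) + 1)) *
    ∏ l ∈ Finset.univ.erase j, windowMass N (stepSide L j l) (v l) (i l)

/-- The flow through the edge `e` that transports the uniform distribution on the grid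
to the point mass at `v`. -/
noncomputable def gridFlow {d N : ℕ} (e : GridEdge d N) (v : GridVertex d N) : ℝ :=
  ∑ L ∈ Finset.Ico 1 N, stepFlow L e.1 v e.2.1

/-- Only the side in direction `j` grows, so the two product weights differ in one factor, a
difference of increments of window distribution functions. Summation by parts moves the increment
onto `θ`, without boundary terms since these functions agree at `0` and at `N`. -/
theorem boxMean_sub_boxMean_succ {d N L : ℕ} (hL : 1 ≤ L) (hLN : L + 1 ≤ N) (j : Fin d)
    (θ : GridVertex d N → ℝ) (v : GridVertex d N) :
    boxMean L j θ v - boxMean L (j + 1) θ v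
      = ∑ i : {i : GridVertex d N // (i j : ℕ) + 1 < N},
          stepFlow L j v i.1 * (gridIncidence d N *ᵥ θ) ⟨j, i⟩ := by
  have h := sum_grid_by_parts (N := N) j
    (fun t => windowCdf N (L + 1) (v j) t - windowCdf N L (v j) t)
    (by simp [windowCdf_zero])
    (by simp [windowCdf_last hL (by omega : L ≤ N), windowCdf_last (by omega : 1 ≤ L + 1) hLN])
    (fun w => ∏ l ∈ Finset.univ.erase j, windowMass N (stepSide L j l) (v l) (w l)) θ
    (by
      intro w a
      refine Finset.prod_congr rfl fun l hl => ?_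
      rw [Function.update_of_ne (Finset.ne_of_mem_erase hl)])
  simp only [gridIncidence_mulVec, stepFlow]
  refine Eq.trans ?_ h.symm
  rw [boxMean, boxMean, ← Finset.sum_sub_distrib]
  refine Finset.sum_congr rfl fun w _ => ?_
  rw [← sub_mul]
  congr 1
  rw [← Finset.mul_prod_erase Finset.univ _ (Finset.mem_univ j),
    ← Finset.mul_prod_erase Finset.univ (fun l : Fin d => windowMass N (stepSide L (j + 1) l) _ _)
      (Finset.mem_univ j)]
  have h1 : ∏ l ∈ Finset.univ.erase j, windowMass N (stepSide L (j + 1) l) (v l) (w l)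
      = ∏ l ∈ Finset.univ.erase j, windowMass N (stepSide L j l) (v l) (w l) := by
    refine Finset.prod_congr rfl fun l hl => ?_
    have : (l : ℕ) ≠ j := fun h => Finset.ne_of_mem_erase hl (Fin.ext h)
    have h2 : stepSide L (j + 1) l = stepSide L j l := by
      unfold stepSide; split_ifs <;> omega
    rw [h2]
  rw [h1, ← sub_mul]
  congr 1
  simp only [stepSide, lt_irrefl, if_false, Nat.lt_succ_self, if_true, windowMass]
  ring

theorem boxMean_sub_boxMean_next {d N L : ℕ} (hL : 1 ≤ L) (hLN : L + 1 ≤ N)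
    (θ : GridVertex d N → ℝ) (v : GridVertex d N) :
    boxMean L 0 θ v - boxMean (L + 1) 0 θ v
      = ∑ e : GridEdge d N, stepFlow L e.1 v e.2.1 * (gridIncidence d N *ᵥ θ) e := by
  rw [Fintype.sum_sigma]
  simp only [← boxMean_sub_boxMean_succ hL hLN]
  rw [Fin.sum_univ_eq_sum_range (fun k => boxMean L k θ v - boxMean L (k + 1) θ v) d,
    Finset.sum_range_sub']
  congr 1
  simp [boxMean, stepSide]

/-- Every function on the grid is its mean plus the flow of its differences. -/
theorem eq_mean_add_sum_gridFlow {d N : ℕ} (hN : 1 ≤ N) (θ : GridVertex d N → ℝ)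
    (v : GridVertex d N) :
    θ v = (1 / (N : ℝ) ^ d) * ∑ w, θ w
      + ∑ e : GridEdge d N, gridFlow e v * (gridIncidence d N *ᵥ θ) e := by
  -- The cube of side `1` is the point `v`, the cube of side `N` the whole grid; the steps between
  -- them telescope.
  have h1 : boxMean 1 0 θ v = θ v := by
    unfold boxMean
    rw [Finset.sum_eq_single v]
    · simp [stepSide, windowMass_one]
    · intro w _ hw
      obtain ⟨l, hl⟩ := Function.ne_iff.mp hw
      rw [Finset.prod_eq_zero (Finset.mem_univ l), zero_mul]
      simp only [stepSide, not_lt_zero, if_false]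
      rw [windowMass_one (v l).2, if_neg]
      exact fun h => hl (Fin.ext h)
    · simp
  have h2 : boxMean N 0 θ v = (1 / (N : ℝ) ^ d) * ∑ w, θ w := by
    simp [boxMean, stepSide, windowMass_full, Finset.mul_sum]
  have h3 : ∑ e : GridEdge d N, gridFlow e v * (gridIncidence d N *ᵥ θ) e
      = ∑ L ∈ Finset.Ico 1 N, (boxMean L 0 θ v - boxMean (L + 1) 0 θ v) := by
    simp only [gridFlow, Finset.sum_mul]
    rw [Finset.sum_comm]
    refine Finset.sum_congr rfl fun L hL => ?_
    rw [Finset.mem_Ico] at hL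
    rw [boxMean_sub_boxMean_next hL.1 hL.2]
  rw [h3, Finset.sum_Ico_eq_sum_range]
  have h4 := Finset.sum_range_sub' (fun k => boxMean (1 + k) 0 θ v) (N - 1)
  simp only [← add_assoc] at h4
  rw [h4, ← h2, Nat.add_sub_cancel' hN, add_zero, h1]
  ring

/-! ### Square sums of the flow. -/

/-- The change of distribution function and each of the `d - 1` masses contribute a factor at most
`1 / L`, and each factor forces its coordinate to be within `L`. -/
theorem abs_stepFlow_le {d N L : ℕ} (hL : 1 ≤ L) (hLN : L + 1 ≤ N) (j : Fin d)
    (v i : GridVertex d N) :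
    |stepFlow L j v i| ≤
      if ∀ l, (v l : ℕ) ≤ i l + L ∧ (i l : ℕ) ≤ v l + L then 1 / (L : ℝ) ^ d else 0 := by
  have hL0 : (0 : ℝ) < L := by exact_mod_cast hL
  split_ifs with h
  · rw [stepFlow, abs_mul, Finset.abs_prod]
    have hd : 0 < d := j.pos
    calc _ ≤ 1 / (L : ℝ) * ∏ l ∈ Finset.univ.erase j, (1 / (L : ℝ)) := by
          refine mul_le_mul (abs_windowCdf_succ_sub_le hL hLN) ?_
            (Finset.prod_nonneg fun _ _ => abs_nonneg _) (by positivity)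
          refine Finset.prod_le_prod (fun _ _ => abs_nonneg _) fun l _ => ?_
          rw [abs_of_nonneg (windowMass_nonneg _ _ _ _)]
          refine (windowMass_le _ _ _ _).trans ?_
          apply one_div_le_one_div_of_le hL0
          unfold stepSide
          split_ifs <;> push_cast <;> linarith
      _ = 1 / (L : ℝ) ^ d := by
          rw [Finset.prod_const, Finset.card_erase_of_mem (Finset.mem_univ j), Finset.card_univ,
            Fintype.card_fin, ← pow_succ', Nat.sub_add_cancel hd, one_div_pow]
  · refine le_of_eq (abs_eq_zero.mpr ?_)
    by_contra h0
    apply h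
    rw [stepFlow] at h0
    have h1 := near_of_windowCdf_succ_sub_ne_zero (v j).2 hL hLN (left_ne_zero_of_mul h0)
    have h2 := Finset.prod_ne_zero_iff.mp (right_ne_zero_of_mul h0)
    intro l
    by_cases hl : l = j
    · subst hl; exact h1
    · have h3 := near_of_windowMass_ne_zero (v l).2 (by unfold stepSide; split_ifs <;> omega)
        (h2 l (by simp [hl]))
      have h4 : stepSide L j l ≤ L + 1 := by unfold stepSide; split_ifs <;> omega
      omega

theorem card_gridVertex_near_le {d N L : ℕ} (hL : 1 ≤ L) (i : GridVertex d N) :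
    (Finset.univ.filter fun v : GridVertex d N =>
      ∀ l, (v l : ℕ) ≤ i l + L ∧ (i l : ℕ) ≤ v l + L).card ≤ (3 * L) ^ d := by
  have h : (Finset.univ.filter fun v : GridVertex d N =>
      ∀ l, (v l : ℕ) ≤ i l + L ∧ (i l : ℕ) ≤ v l + L)
      = Fintype.piFinset fun l => Finset.univ.filter fun a : Fin N =>
          (a : ℕ) ≤ i l + L ∧ (i l : ℕ) ≤ a + L := by
    ext v; simp
  rw [h, Fintype.card_piFinset]
  refine (Finset.prod_le_pow_card _ _ (3 * L) fun l _ => ?_).trans (by simp)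
  have h2 : (Finset.univ.filter fun a : Fin N => (a : ℕ) ≤ i l + L ∧ (i l : ℕ) ≤ a + L).card
      ≤ (Finset.Icc ((i l : ℕ) - L) (i l + L)).card := by
    refine Finset.card_le_card_of_injOn (fun a => (a : ℕ)) ?_ fun a _ b _ hab => Fin.ext hab
    intro a ha
    simp at ha ⊢
    omega
  rw [Nat.card_Icc] at h2
  omega

/-- Expand the square over pairs of scales `L ≤ L'`. The bound at scale `L` has total mass at most
`3 ^ d`, the one at scale `L'` is at most `L'^{-d}` pointwise, and at most `L'` scales `L` pair with
`L'`. The factor `2` counts both orders. -/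
theorem sum_sq_gridFlow_le_sum {d N : ℕ} (e : GridEdge d N) :
    ∑ v, gridFlow e v ^ 2 ≤ 2 * 3 ^ d * ∑ L ∈ Finset.Ico 1 N, (L : ℝ) / (L : ℝ) ^ d := by
  classical
  set near : ℕ → GridVertex d N → Prop := fun L v =>
    ∀ l, (v l : ℕ) ≤ e.2.1 l + L ∧ (e.2.1 l : ℕ) ≤ v l + L
  set b : ℕ → GridVertex d N → ℝ := fun L v => if near L v then 1 / (L : ℝ) ^ d else 0
  have hb0 : ∀ L v, 0 ≤ b L v := fun L v => by simp only [b]; split_ifs <;> positivity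
  have hble : ∀ L v, b L v ≤ 1 / (L : ℝ) ^ d := fun L v => by
    simp only [b]; split_ifs
    · exact le_rfl
    · positivity
  have hbsum : ∀ L, 1 ≤ L → ∑ v, b L v ≤ 3 ^ d := fun L hL => by
    have hL0 : (0 : ℝ) < L := by exact_mod_cast hL
    simp only [b]
    rw [← Finset.sum_filter, Finset.sum_const, nsmul_eq_mul]
    have hcard := card_gridVertex_near_le hL e.2.1
    have hcard' : ((Finset.univ.filter (near L)).card : ℝ) ≤ (3 * L) ^ d := by
      exact_mod_cast hcard
    rw [mul_one_div, div_le_iff₀ (by positivity), ← mul_pow]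
    exact hcard'
  have hcross : ∀ L L', 1 ≤ L → L ≤ L' → ∑ v, b L v * b L' v ≤ 3 ^ d / (L' : ℝ) ^ d :=
    fun L L' hL hLL => by
      calc ∑ v, b L v * b L' v ≤ ∑ v, b L v * (1 / (L' : ℝ) ^ d) :=
            Finset.sum_le_sum fun v _ => mul_le_mul_of_nonneg_left (hble _ _) (hb0 _ _)
        _ = (∑ v, b L v) * (1 / (L' : ℝ) ^ d) := by rw [Finset.sum_mul]
        _ ≤ 3 ^ d * (1 / (L' : ℝ) ^ d) := by
            gcongr; exact hbsum L hL
        _ = _ := by ring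
  set c : ℕ → ℝ := fun L => 3 ^ d / (L : ℝ) ^ d
  have hc0 : ∀ L, 0 ≤ c L := fun L => by positivity
  have hhalf : ∑ L ∈ Finset.Ico 1 N, ∑ L' ∈ Finset.Ico 1 N, (if L ≤ L' then c L' else 0)
      ≤ 3 ^ d * ∑ L ∈ Finset.Ico 1 N, (L : ℝ) / (L : ℝ) ^ d := by
    rw [Finset.sum_comm, Finset.mul_sum]
    refine Finset.sum_le_sum fun L' _ => ?_
    rw [← Finset.sum_filter, Finset.sum_const, nsmul_eq_mul]
    have h1 : ((Finset.Ico 1 N).filter (· ≤ L')).card ≤ L' := by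
      calc _ ≤ (Finset.Icc 1 L').card := Finset.card_le_card fun x hx => by
            simp at hx ⊢; omega
        _ = L' := by simp
    calc _ ≤ (L' : ℝ) * c L' := by
          gcongr
      _ = _ := by simp only [c]; ring
  have hhalf' : ∑ L ∈ Finset.Ico 1 N, ∑ L' ∈ Finset.Ico 1 N, (if L' ≤ L then c L else 0)
      ≤ 3 ^ d * ∑ L ∈ Finset.Ico 1 N, (L : ℝ) / (L : ℝ) ^ d := by
    rw [Finset.sum_comm]; exact hhalf
  calc ∑ v, gridFlow e v ^ 2 ≤ ∑ v, (∑ L ∈ Finset.Ico 1 N, b L v) ^ 2 := by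
        refine Finset.sum_le_sum fun v _ => sq_le_sq' ?_ ?_
        all_goals
          have h1 : |gridFlow e v| ≤ ∑ L ∈ Finset.Ico 1 N, b L v := by
            refine (Finset.abs_sum_le_sum_abs _ _).trans (Finset.sum_le_sum fun L hL => ?_)
            rw [Finset.mem_Ico] at hL
            exact abs_stepFlow_le hL.1 hL.2 _ _ _
          have := abs_le.mp h1
          linarith
    _ = ∑ L ∈ Finset.Ico 1 N, ∑ L' ∈ Finset.Ico 1 N, ∑ v, b L v * b L' v := by
        simp only [sq, Finset.sum_mul_sum]
        rw [Finset.sum_comm]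
        refine Finset.sum_congr rfl fun L _ => ?_
        rw [Finset.sum_comm]
    _ ≤ ∑ L ∈ Finset.Ico 1 N, ∑ L' ∈ Finset.Ico 1 N,
          ((if L ≤ L' then c L' else 0) + if L' ≤ L then c L else 0) := by
        refine Finset.sum_le_sum fun L hL => Finset.sum_le_sum fun L' hL' => ?_
        rw [Finset.mem_Ico] at hL hL'
        rcases le_total L L' with h | h
        · have := hcross L L' hL.1 h
          rw [if_pos h]
          split_ifs <;> linarith [hc0 L]
        · have := hcross L' L hL'.1 h
          simp only [mul_comm (b L' _)] at this
          rw [if_pos h]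
          split_ifs <;> linarith [hc0 L']
    _ ≤ _ := by
        simp only [Finset.sum_add_distrib]
        linarith

theorem sum_Ico_div_pow_le_rateFactor {d N : ℕ} (hd : 2 ≤ d) (hN : 2 ≤ N) :
    ∑ L ∈ Finset.Ico 1 N, (L : ℝ) / (L : ℝ) ^ d ≤ 2 * rateFactor d (N ^ d) := by
  unfold rateFactor
  split_ifs with h
  · subst h
    have h1 : ∑ L ∈ Finset.Ico 1 N, (L : ℝ) / (L : ℝ) ^ 2 = (harmonic (N - 1) : ℝ) := by
      rw [harmonic_eq_sum_Icc]
      push_cast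
      refine Finset.sum_congr (by ext; simp; omega) fun L hL => ?_
      have : (L : ℝ) ≠ 0 := by
        simp at hL; exact_mod_cast (by omega : L ≠ 0)
      field_simp
    have h2 := harmonic_le_one_add_log (N - 1)
    have h3 : Real.log ((N - 1 : ℕ) : ℝ) ≤ Real.log N :=
      Real.log_le_log (by exact_mod_cast (by omega : 0 < N - 1)) (by exact_mod_cast Nat.sub_le N 1)
    have h4 : Real.log 2 ≤ Real.log N := Real.log_le_log (by norm_num) (by exact_mod_cast hN)
    have h5 := Real.log_two_gt_d9
    -- Here `rateFactor` is `log (N ^ 2) = 2 log N`, so the target is `4 log N`; the `1` in `1 + log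
    -- N` is absorbed because `3 log 2 ≥ 1`.
    rw [h1]
    push_cast
    rw [Real.log_pow]
    push_cast
    linarith
  · have key : ∀ m : ℕ, ∑ L ∈ Finset.Ico 1 (m + 2), 1 / (L : ℝ) ^ 2 ≤ 2 - 1 / ((m : ℝ) + 1) := by
      intro m
      induction m with
      | zero => norm_num
      | succ m ih =>
        rw [Finset.sum_Ico_succ_top (by omega)]
        have h1 : 1 / (((m + 2 : ℕ) : ℝ)) ^ 2 ≤ 1 / ((m : ℝ) + 1) - 1 / ((m : ℝ) + 2) := by
          rw [div_sub_div _ _ (by positivity) (by positivity),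
            div_le_div_iff₀ (by positivity) (by positivity)]
          push_cast
          nlinarith [(Nat.cast_nonneg m : (0 : ℝ) ≤ m)]
        push_cast at *
        have e : (m : ℝ) + 1 + 1 = m + 2 := by ring
        rw [e]
        linarith
    obtain ⟨m, rfl⟩ := Nat.exists_eq_add_of_le' hN
    calc _ ≤ ∑ L ∈ Finset.Ico 1 (m + 2), 1 / (L : ℝ) ^ 2 := by
          refine Finset.sum_le_sum fun L hL => ?_
          rw [Finset.mem_Ico] at hL
          have hL1 : (1 : ℝ) ≤ L := by exact_mod_cast hL.1
          rw [div_le_div_iff₀ (by positivity) (by positivity), one_mul, ← pow_succ']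
          exact pow_le_pow_right₀ hL1 (by omega)
      _ ≤ 2 * 1 := by
          refine (key m).trans ?_
          have : 0 ≤ 1 / ((m : ℝ) + 1) := by positivity
          linarith

theorem sum_sq_gridFlow_le {d N : ℕ} (hd : 2 ≤ d) (e : GridEdge d N) :
    ∑ v, gridFlow e v ^ 2 ≤ 4 * 3 ^ d * rateFactor d (N ^ d) := by
  have hN : 2 ≤ N := by have := e.2.2; omega
  have h1 := sum_Ico_div_pow_le_rateFactor hd hN
  have h2 := sum_sq_gridFlow_le_sum e
  have h3 : (0 : ℝ) < 2 * 3 ^ d := by positivity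
  nlinarith

/-! ### The deterministic oracle inequality. -/

/-- `(a - b)² ≤ 2a² + 2b²`, and in each direction a vertex is at most once a lower and at most once
an upper endpoint. -/
theorem sum_sq_gridIncidence_mulVec_le {d N : ℕ} (h : GridVertex d N → ℝ) :
    ∑ e : GridEdge d N, ((gridIncidence d N *ᵥ h) e) ^ 2 ≤ 4 * d * ∑ v, h v ^ 2 := by
  rw [Fintype.sum_sigma]
  have key : ∀ j : Fin d, ∑ i : {i : GridVertex d N // (i j : ℕ) + 1 < N},
      ((gridIncidence d N *ᵥ h) ⟨j, i⟩) ^ 2 ≤ 4 * ∑ v, h v ^ 2 := by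
    intro j
    have h1 : ∑ i : {i : GridVertex d N // (i j : ℕ) + 1 < N}, h i.1 ^ 2 ≤ ∑ v, h v ^ 2 := by
      have := Finset.sum_le_sum_of_subset_of_nonneg
        (Finset.subset_univ (Finset.univ.map (Function.Embedding.subtype
          fun i : GridVertex d N => (i j : ℕ) + 1 < N)))
        (f := fun v => h v ^ 2) (fun _ _ _ => sq_nonneg _)
      simpa using this
    have h2 : ∑ i : {i : GridVertex d N // (i j : ℕ) + 1 < N}, h (GridEdge.upper ⟨j, i⟩) ^ 2
        ≤ ∑ v, h v ^ 2 := by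
      have hinj : Function.Injective
          fun i : {i : GridVertex d N // (i j : ℕ) + 1 < N} => GridEdge.upper ⟨j, i⟩ := by
        intro a b hab
        ext l
        have hl := congrArg (fun f : GridVertex d N => ((f l : Fin N) : ℕ)) hab
        by_cases hlj : l = j
        · subst hlj; simpa [GridEdge.upper] using hl
        · simpa [GridEdge.upper, hlj] using hl
      have := Finset.sum_le_sum_of_subset_of_nonneg
        (Finset.subset_univ (Finset.univ.map ⟨_, hinj⟩))
        (f := fun v => h v ^ 2) (fun _ _ _ => sq_nonneg _)
      simpa using this
    calc _ ≤ ∑ i : {i : GridVertex d N // (i j : ℕ) + 1 < N},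
          (2 * h (GridEdge.upper ⟨j, i⟩) ^ 2 + 2 * h i.1 ^ 2) := by
          refine Finset.sum_le_sum fun i _ => ?_
          rw [gridIncidence_mulVec]
          change (h (GridEdge.upper ⟨j, i⟩) - h i.1) ^ 2 ≤ _
          nlinarith [sq_nonneg (h (GridEdge.upper ⟨j, i⟩) + h i.1)]
      _ ≤ _ := by
          rw [Finset.sum_add_distrib, ← Finset.mul_sum, ← Finset.mul_sum]
          linarith
  calc _ ≤ ∑ _j : Fin d, 4 * ∑ v, h v ^ 2 := Finset.sum_le_sum fun j _ => key j
    _ = _ := by simp; ring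

/-- The deterministic part of the oracle inequality for the total variation denoiser. -/
theorem sum_sq_sub_le_of_isTVDenoiser {d N : ℕ} (hN : 1 ≤ N) {lam a : ℝ} (hlam : 0 ≤ lam)
    (ha : 0 ≤ a) {θ₀ θ z y : GridVertex d N → ℝ} (hy : ∀ v, y v = θ₀ v + z v)
    (hθ : IsTVDenoiser (gridIncidence d N) lam y θ) (S : Finset (GridEdge d N))
    (hS : ∀ e ∉ S, (gridIncidence d N *ᵥ θ₀) e = 0)
    (hmean : |∑ v, z v| ≤ Real.sqrt ((N : ℝ) ^ d) * a)
    (hflow : ∀ e : GridEdge d N, 2 * |∑ v, gridFlow e v * z v| ≤ (N : ℝ) ^ d * lam) :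
    ∑ v, (θ v - θ₀ v) ^ 2 ≤ 8 * a ^ 2 + 32 * ((N : ℝ) ^ d * lam) ^ 2 * d * S.card := by
  classical
  set n : ℝ := (N : ℝ) ^ d with hn
  have hn0 : 0 < n := by positivity
  set D := gridIncidence d N
  set h : GridVertex d N → ℝ := fun v => θ v - θ₀ v with hh
  set X : ℝ := ∑ v, h v ^ 2 with hX
  have hX0 : 0 ≤ X := Finset.sum_nonneg fun _ _ => sq_nonneg _
  have hDh : ∀ e, (D *ᵥ h) e = (D *ᵥ θ) e - (D *ᵥ θ₀) e := by
    intro e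
    simp only [D, gridIncidence_mulVec, hh]
    ring
  -- The basic inequality: compare the minimizer with the truth `θ₀`.
  have basic : X ≤ 2 * ∑ v, h v * z v + n * lam * (∑ e, |(D *ᵥ θ₀) e| - ∑ e, |(D *ᵥ θ) e|) := by
    have h1 := hθ θ₀
    have hcard : (Fintype.card (GridVertex d N) : ℝ) = n := by simp [hn]
    unfold tvObjective at h1
    rw [hcard] at h1
    have h2 : ∑ v, (θ v - y v) ^ 2 = X - 2 * ∑ v, h v * z v + ∑ v, (θ₀ v - y v) ^ 2 := by
      rw [hX, Finset.mul_sum, ← Finset.sum_sub_distrib, ← Finset.sum_add_distrib]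
      refine Finset.sum_congr rfl fun v _ => ?_
      rw [hy, hh]; ring
    rw [h2] at h1
    have h3 := mul_le_mul_of_nonneg_left h1 hn0.le
    have e1 : ∀ A B : ℝ, n * (1 / n * A + lam * B) = A + n * lam * B := by
      intro A B; field_simp
    rw [e1, e1] at h3
    linarith
  have hsplit : ∑ v, h v * z v = (1 / n) * (∑ v, h v) * ∑ v, z v
      + ∑ e : GridEdge d N, (∑ v, gridFlow e v * z v) * (D *ᵥ h) e := by
    calc ∑ v, h v * z v = ∑ v, ((1 / n) * ∑ w, h w
          + ∑ e : GridEdge d N, gridFlow e v * (D *ᵥ h) e) * z v :=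
          Finset.sum_congr rfl fun v _ => by rw [← eq_mean_add_sum_gridFlow hN h v]
      _ = _ := by
          simp only [add_mul, Finset.sum_add_distrib, ← Finset.mul_sum]
          congr 1
          simp only [Finset.sum_mul]
          rw [Finset.sum_comm]
          refine Finset.sum_congr rfl fun e _ => Finset.sum_congr rfl fun v _ => by ring
  have hsum : |∑ v, h v| ≤ Real.sqrt n * Real.sqrt X := by
    rw [← Real.sqrt_mul hn0.le]
    apply Real.abs_le_sqrt
    have := sq_sum_le_card_mul_sum_sq (s := Finset.univ) (f := h)
    simpa [hn] using this
  have hfirst : (1 / n) * (∑ v, h v) * ∑ v, z v ≤ a * Real.sqrt X := by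
    calc _ ≤ (1 / n) * (|∑ v, h v| * |∑ v, z v|) := by
          rw [← abs_mul, mul_assoc]
          gcongr
          exact le_abs_self _
      _ ≤ (1 / n) * ((Real.sqrt n * Real.sqrt X) * (Real.sqrt n * a)) := by gcongr
      _ = (1 / n) * (Real.sqrt n * Real.sqrt n) * (a * Real.sqrt X) := by ring
      _ = _ := by rw [Real.mul_self_sqrt hn0.le]; field_simp
  have hsecond : 2 * ∑ e : GridEdge d N, (∑ v, gridFlow e v * z v) * (D *ᵥ h) e
      ≤ n * lam * ∑ e, |(D *ᵥ h) e| := by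
    rw [Finset.mul_sum, Finset.mul_sum]
    refine Finset.sum_le_sum fun e _ => ?_
    calc _ ≤ (2 * |∑ v, gridFlow e v * z v|) * |(D *ᵥ h) e| := by
          rw [mul_assoc, ← abs_mul]
          gcongr
          exact le_abs_self _
      _ ≤ _ := mul_le_mul_of_nonneg_right (hflow e) (abs_nonneg _)
  -- On `S` the triangle inequality gives `2|Dh|`; off `S`, `Dθ₀ = 0` and `Dh = Dθ`, so the terms
  -- cancel.
  have hcone : ∑ e, |(D *ᵥ h) e| + (∑ e, |(D *ᵥ θ₀) e| - ∑ e, |(D *ᵥ θ) e|)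
      ≤ 2 * ∑ e ∈ S, |(D *ᵥ h) e| := by
    rw [← Finset.sum_sub_distrib, ← Finset.sum_add_distrib, Finset.mul_sum]
    calc _ ≤ ∑ e, if e ∈ S then 2 * |(D *ᵥ h) e| else 0 := by
          refine Finset.sum_le_sum fun e _ => ?_
          split_ifs with he
          · have := abs_sub_abs_le_abs_sub ((D *ᵥ θ₀) e) ((D *ᵥ θ) e)
            rw [abs_sub_comm, ← hDh] at this
            linarith
          · have := hDh e
            rw [hS e he, sub_zero] at this
            simp [this, hS e he]
      _ = _ := by simp
  have hCS : ∑ e ∈ S, |(D *ᵥ h) e| ≤ Real.sqrt (4 * d * S.card) * Real.sqrt X := by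
    rw [← Real.sqrt_mul (by positivity)]
    apply Real.le_sqrt_of_sq_le
    have h1 := sq_sum_le_card_mul_sum_sq (s := S) (f := fun e => |(D *ᵥ h) e|)
    simp only [sq_abs] at h1
    have h2 : ∑ e ∈ S, ((D *ᵥ h) e) ^ 2 ≤ 4 * d * X :=
      (Finset.sum_le_sum_of_subset_of_nonneg (Finset.subset_univ S)
        (fun _ _ _ => sq_nonneg _)).trans (sum_sq_gridIncidence_mulVec_le h)
    calc _ ≤ (S.card : ℝ) * (4 * d * X) := h1.trans (by gcongr)
      _ = _ := by ring
  have hnl : 0 ≤ n * lam := by positivity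
  set s := Real.sqrt (4 * d * S.card) with hs
  have hs0 : 0 ≤ s := Real.sqrt_nonneg _
  have hs2 : s ^ 2 = 4 * d * S.card := Real.sq_sqrt (by positivity)
  set x := Real.sqrt X with hx
  have hx0 : 0 ≤ x := Real.sqrt_nonneg _
  have hx2 : x ^ 2 = X := Real.sq_sqrt hX0
  have hmain : X ≤ (2 * a + 2 * (n * lam) * s) * x := by
    have h1 := mul_le_mul_of_nonneg_left hcone hnl
    have h2 := mul_le_mul_of_nonneg_left hCS hnl
    rw [hsplit] at basic
    nlinarith
  have hxle : x ≤ 2 * a + 2 * (n * lam) * s := by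
    by_contra hc
    push Not at hc
    have : 0 ≤ 2 * a + 2 * (n * lam) * s := by positivity
    nlinarith
  calc X = x ^ 2 := hx2.symm
    _ ≤ (2 * a + 2 * (n * lam) * s) ^ 2 := by gcongr
    _ ≤ 8 * a ^ 2 + 8 * (n * lam) ^ 2 * s ^ 2 := by nlinarith [sq_nonneg (a - n * lam * s)]
    _ = _ := by rw [hs2]; ring

/-! ### Counting the edges where a piecewise constant function jumps. -/

/-- A function that is locally constant on the cube off `B` takes the same value at two points of
the cube if the segment between them does not meet `B`. -/
theorem eq_of_segment_disjoint {d : ℕ} {B : Set (EuclideanSpace ℝ (Fin d))}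
    {f : EuclideanSpace ℝ (Fin d) → ℝ}
    (hf : ∀ x ∈ unitCube d \ B, ∃ ε : ℝ, 0 < ε ∧ ∀ y, ‖y - x‖ < ε → f x = f y)
    {x y : EuclideanSpace ℝ (Fin d)} (hx : x ∈ unitCube d) (hy : y ∈ unitCube d)
    (hB : ∀ t ∈ Set.Icc (0 : ℝ) 1, x + t • (y - x) ∉ B) : f x = f y := by
  have hmem : ∀ t ∈ Set.Icc (0 : ℝ) 1, x + t • (y - x) ∈ unitCube d := by
    intro t ht k
    have h1 := hx k
    have h2 := hy k
    simp only [PiLp.add_apply, PiLp.smul_apply, PiLp.sub_apply, smul_eq_mul]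
    constructor <;> nlinarith [ht.1, ht.2]
  have hloc : ∀ t ∈ Set.Icc (0 : ℝ) 1,
      (fun s : ℝ => f (x + s • (y - x))) =ᶠ[nhds t] fun _ => f (x + t • (y - x)) := by
    intro t ht
    obtain ⟨ε, hε, h⟩ := hf _ ⟨hmem t ht, hB t ht⟩
    have hcont : Continuous fun s : ℝ => x + s • (y - x) := by fun_prop
    filter_upwards [hcont.continuousAt.preimage_mem_nhds (Metric.ball_mem_nhds _ hε)] with s hs
    exact (h _ (by simpa [dist_eq_norm] using hs)).symm
  -- Being locally constant along the segment, `f` has zero derivative there.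
  have key := constant_of_has_deriv_right_zero (a := (0 : ℝ)) (b := 1)
    (f := fun s : ℝ => f (x + s • (y - x)))
    (fun t ht => ((continuousAt_const.congr (hloc t ht).symm)).continuousWithinAt)
    (fun t ht => ((hasDerivAt_const t _).congr_of_eventuallyEq
      (hloc t ⟨ht.1, ht.2.le⟩)).hasDerivWithinAt)
  have h1 := key 1 (by simp)
  simpa using h1.symm

theorem gridPoint_mem_unitCube {d N : ℕ} (i : GridVertex d N) : gridPoint i ∈ unitCube d := by
  intro k
  have h1 := (i k).2
  have h2 : ((i k : ℕ) : ℝ) + 1 ≤ N := by exact_mod_cast h1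
  have h3 : (0 : ℝ) < N := by
    have := Nat.cast_nonneg (α := ℝ) (i k : ℕ)
    linarith
  simp only [gridPoint]
  exact ⟨by positivity, (div_le_one h3).mpr h2⟩

theorem norm_gridPoint_upper_sub_lower {d N : ℕ} (e : GridEdge d N) :
    ‖gridPoint e.upper - gridPoint e.lower‖ = 1 / (N : ℝ) := by
  have h : gridPoint e.upper - gridPoint e.lower = EuclideanSpace.single e.1 (1 / (N : ℝ)) := by
    ext k
    by_cases hk : k = e.1
    · subst hk
      simp [gridPoint, GridEdge.upper, GridEdge.lower]
      ring
    · simp [gridPoint, GridEdge.upper, GridEdge.lower, hk]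
  rw [h, PiLp.norm_single, Real.norm_of_nonneg (by positivity)]

theorem card_fin_abs_sub_le (N : ℕ) (x : ℝ) :
    (Finset.univ.filter fun a : Fin N => |((a : ℕ) : ℝ) - x| ≤ 2).card ≤ 5 := by
  have h : (Finset.univ.filter fun a : Fin N => |((a : ℕ) : ℝ) - x| ≤ 2).card
      ≤ (Finset.Icc (⌈x⌉ - 2) (⌈x⌉ + 2)).card := by
    refine Finset.card_le_card_of_injOn (fun a => ((a : ℕ) : ℤ)) ?_ ?_
    · intro a ha
      simp only [Finset.coe_filter, Finset.mem_univ, true_and, Set.mem_ofPred_eq, abs_le] at ha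
      have h1 := Int.le_ceil x
      have h2 := Int.ceil_lt_add_one x
      simp only [Finset.coe_Icc, Set.mem_Icc]
      constructor
      · have : ((⌈x⌉ : ℝ)) - 3 < ((a : ℕ) : ℝ) := by linarith
        have : ⌈x⌉ - 3 < ((a : ℕ) : ℤ) := by exact_mod_cast this
        omega
      · have : ((a : ℕ) : ℝ) ≤ ⌈x⌉ + 2 := by linarith
        exact_mod_cast this
    · intro a _ b _ hab
      simpa [Fin.ext_iff] using hab
  refine h.trans (le_of_eq ?_)
  rw [Int.card_Icc]
  ring_nf
  rfl

/-- After scaling by `N`, each coordinate of the lower endpoint lies within `2` of `N * c k - 1`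
(the shift comes from indexing at `0`), leaving at most `5` values; the edge has `d` possible
directions. -/
theorem card_gridEdge_near_le {d N : ℕ} (hN : 1 ≤ N) (c : EuclideanSpace ℝ (Fin d)) :
    (Finset.univ.filter fun e : GridEdge d N => ‖gridPoint e.lower - c‖ ≤ 2 / (N : ℝ)).card
      ≤ d * 5 ^ d := by
  have hN0 : (0 : ℝ) < N := by exact_mod_cast hN
  set A : Finset (GridVertex d N) := Fintype.piFinset fun k =>
    Finset.univ.filter fun a : Fin N => |((a : ℕ) : ℝ) - (N * c k - 1)| ≤ 2
  have hA : A.card ≤ 5 ^ d := by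
    rw [Fintype.card_piFinset]
    exact (Finset.prod_le_pow_card _ _ 5 fun l _ => card_fin_abs_sub_le _ _).trans (by simp)
  calc _ ≤ ((Finset.univ : Finset (Fin d)) ×ˢ A).card := by
        refine Finset.card_le_card_of_injOn (fun e => (e.1, e.lower)) ?_ ?_
        · intro e he
          simp only [Finset.coe_filter, Finset.mem_univ, true_and, Set.mem_ofPred_eq] at he
          simp only [Finset.coe_product, Finset.coe_univ, Set.mem_prod, Set.mem_univ, true_and,
            Finset.mem_coe, A, Fintype.mem_piFinset, Finset.mem_filter, Finset.mem_univ]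
          intro k
          have h1 := (PiLp.norm_apply_le (gridPoint e.lower - c) k).trans he
          simp only [PiLp.sub_apply, gridPoint, Real.norm_eq_abs] at h1
          rw [le_div_iff₀ hN0, ← abs_of_pos hN0, ← abs_mul, abs_of_pos hN0] at h1
          have h2 : (((e.lower k : ℕ) : ℝ) - (N * c k - 1))
              = ((((e.lower k : ℕ) : ℝ) + 1) / N - c k) * N := by
            field_simp
            ring
          rw [h2]
          exact h1
        · rintro ⟨j, i⟩ _ ⟨j', i'⟩ _ h
          simp only [GridEdge.lower, Prod.mk.injEq] at h
          obtain ⟨rfl, h⟩ := h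
          rw [Subtype.ext h]
    _ ≤ d * 5 ^ d := by
        rw [Finset.card_product]
        simp only [Finset.card_univ, Fintype.card_fin]
        gcongr

/-- The number of grid edges across which a piecewise constant function jumps. -/
theorem card_jump_edges_le {d N : ℕ} (hN : 1 ≤ N) {β : ℝ} (hβ : 0 < β)
    {f : EuclideanSpace ℝ (Fin d) → ℝ} (hf : IsPiecewiseConstant d β f) :
    ((Finset.univ.filter fun e : GridEdge d N =>
      f (gridPoint e.upper) ≠ f (gridPoint e.lower)).card : ℝ)
      ≤ d * 5 ^ d * (β * (N : ℝ) ^ (d - 1)) := by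
  classical
  obtain ⟨B, -, hloc, hcov⟩ := hf
  have hN0 : (0 : ℝ) < N := by exact_mod_cast hN
  set r : ℝ≥0 := (N : ℝ≥0)⁻¹ with hr
  have hrv : (r : ℝ) = 1 / N := by simp [hr]
  have h1 := hcov r (by rw [hr]; positivity)
    (by rw [hr]; exact inv_le_one_of_one_le₀ (by exact_mod_cast hN))
  rw [hrv, one_div, inv_pow, div_inv_eq_mul] at h1
  have hne : Metric.externalCoveringNumber r B ≠ ⊤ := by
    intro h
    rw [h] at h1
    simp at h1
  obtain ⟨m, hm⟩ := ENat.ne_top_iff_exists.mp hne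
  -- The covering number is an infimum; being strictly below `m + 1` it yields an actual cover by at
  -- most `m` balls.
  obtain ⟨C, hC, hCm⟩ : ∃ C : Set (EuclideanSpace ℝ (Fin d)), Metric.IsCover r B C ∧
      C.encard < m + 1 := by
    have : Metric.externalCoveringNumber r B < (m : ℕ∞) + 1 := by
      rw [← hm]; exact_mod_cast Nat.lt_succ_self m
    unfold Metric.externalCoveringNumber at this
    simp only [iInf_lt_iff] at this
    obtain ⟨C, hC, h⟩ := this
    exact ⟨C, hC, h⟩
  have hCm' : C.encard ≤ m := ENat.lt_add_one_iff (by simp) |>.mp hCm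
  have hCfin : C.Finite := Set.finite_of_encard_le_coe hCm'
  have hcardC : hCfin.toFinset.card ≤ m := by
    rw [hCfin.encard_eq_coe_toFinset_card] at hCm'
    exact_mod_cast hCm'
  have hmβ : (m : ℝ) ≤ β * (N : ℝ) ^ (d - 1) := by
    rw [← hm] at h1
    have h2 : ENNReal.ofReal (m : ℝ) ≤ ENNReal.ofReal (β * (N : ℝ) ^ (d - 1)) := by
      simpa using h1
    exact (ENNReal.ofReal_le_ofReal_iff (by positivity)).mp h2
  have hsub : (Finset.univ.filter fun e : GridEdge d N =>
      f (gridPoint e.upper) ≠ f (gridPoint e.lower)) ⊆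
      hCfin.toFinset.biUnion fun c => Finset.univ.filter fun e : GridEdge d N =>
        ‖gridPoint e.lower - c‖ ≤ 2 / (N : ℝ) := by
    intro e he
    simp only [Finset.mem_filter, Finset.mem_univ, true_and] at he
    obtain ⟨t, ht, htB⟩ : ∃ t ∈ Set.Icc (0 : ℝ) 1,
        gridPoint e.lower + t • (gridPoint e.upper - gridPoint e.lower) ∈ B := by
      by_contra hcon
      push Not at hcon
      exact he (eq_of_segment_disjoint hloc (gridPoint_mem_unitCube _)
        (gridPoint_mem_unitCube _) hcon).symm
    obtain ⟨c, hc, hdist⟩ := hC htB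
    simp only [Finset.mem_biUnion, Set.Finite.mem_toFinset, Finset.mem_filter, Finset.mem_univ,
      true_and]
    refine ⟨c, hc, ?_⟩
    have h2 : dist (gridPoint e.lower + t • (gridPoint e.upper - gridPoint e.lower)) c ≤ r := by
      have h3 : edist (gridPoint e.lower + t • (gridPoint e.upper - gridPoint e.lower)) c ≤ r :=
        hdist
      rw [edist_nndist] at h3
      exact_mod_cast h3
    rw [hrv, dist_eq_norm] at h2
    have h4 : ‖t • (gridPoint e.upper - gridPoint e.lower)‖ ≤ 1 / N := by
      rw [norm_smul, norm_gridPoint_upper_sub_lower, Real.norm_of_nonneg ht.1]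
      exact mul_le_of_le_one_left (by positivity) ht.2
    -- The boundary point on the edge is within `1 / N` of both the lower endpoint and the centre.
    have h5 : gridPoint e.lower - c
        = (gridPoint e.lower + t • (gridPoint e.upper - gridPoint e.lower) - c)
          - t • (gridPoint e.upper - gridPoint e.lower) := by abel
    rw [h5]
    refine (norm_sub_le _ _).trans ?_
    calc _ ≤ 1 / (N : ℝ) + 1 / N := add_le_add h2 h4
      _ = _ := by ring
  have hcard : (Finset.univ.filter fun e : GridEdge d N =>
      f (gridPoint e.upper) ≠ f (gridPoint e.lower)).card ≤ m * (d * 5 ^ d) :=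
    (Finset.card_le_card hsub).trans ((Finset.card_biUnion_le_card_mul _ _ _
      fun c _ => card_gridEdge_near_le hN c).trans (Nat.mul_le_mul_right _ hcardC))
  have hcard' : ((Finset.univ.filter fun e : GridEdge d N =>
      f (gridPoint e.upper) ≠ f (gridPoint e.lower)).card : ℝ) ≤ m * (d * 5 ^ d) := by
    exact_mod_cast hcard
  calc _ ≤ (m : ℝ) * (d * 5 ^ d) := hcard'
    _ ≤ β * (N : ℝ) ^ (d - 1) * (d * 5 ^ d) := by gcongr
    _ = _ := by ring

/-! ### Gaussian tail bounds. -/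

theorem hasSubgaussianMGF_id_gaussianReal (v : ℝ≥0) :
    HasSubgaussianMGF (fun x : ℝ => x) v (gaussianReal 0 v) where
  integrable_exp_mul t := integrable_exp_mul_gaussianReal t
  mgf_le t := by rw [mgf_fun_id_gaussianReal]; simp

/-- Two-sided tail bound for a linear form in independent standard Gaussian variables. -/
theorem measure_abs_sum_ge_le {V : Type*} [Fintype V] (g : V → ℝ) {R t : ℝ} (ht : 0 ≤ t)
    (hR : ∑ v, g v ^ 2 ≤ R) :
    (gaussianNoise V 1) {z | t < |∑ v, g v * z v|}
      ≤ ENNReal.ofReal (2 * Real.exp (-t ^ 2 / (2 * R))) := by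
  unfold gaussianNoise
  set γ : Measure ℝ := gaussianReal 0 (Real.toNNReal (1 ^ 2))
  set P : Measure (V → ℝ) := Measure.pi fun _ => γ
  set X : V → (V → ℝ) → ℝ := fun v z => g v * z v
  have hind : iIndepFun X P :=
    iIndepFun_pi (X := fun v x => g v * x) (μ := fun _ : V => γ) fun v => by fun_prop
  have hsub : ∀ v ∈ (Finset.univ : Finset V),
      HasSubgaussianMGF (X v) (⟨g v ^ 2, sq_nonneg _⟩ : ℝ≥0) P := by
    intro v _
    have h0 : HasSubgaussianMGF (fun x : ℝ => x) 1 γ := by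
      have := hasSubgaussianMGF_id_gaussianReal (Real.toNNReal (1 ^ 2))
      simpa [γ] using this
    have h1 := h0.const_mul (g v)
    have hmp := measurePreserving_eval (fun _ : V => γ) v
    have h2 : HasSubgaussianMGF (fun x : ℝ => g v * x) (⟨g v ^ 2, sq_nonneg _⟩ : ℝ≥0)
        (P.map (Function.eval v)) := by
      have h3 : (⟨g v ^ 2, sq_nonneg _⟩ : ℝ≥0) = ⟨g v ^ 2, sq_nonneg _⟩ * 1 := (mul_one _).symm
      rw [hmp.map_eq, h3]
      exact h1
    exact HasSubgaussianMGF.of_map hmp.measurable.aemeasurable h2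
  have hsum := HasSubgaussianMGF.sum_of_iIndepFun hind hsub
  set c : ℝ≥0 := ∑ v, (⟨g v ^ 2, sq_nonneg _⟩ : ℝ≥0)
  have hcv : (c : ℝ) = ∑ v, g v ^ 2 := NNReal.coe_sum _ _
  have hc : (c : ℝ) ≤ R := hcv.trans_le hR
  have hup := hsum.measure_ge_le ht
  have hdown := hsum.neg.measure_ge_le ht
  have hexp : (c : ℝ) ≠ 0 → Real.exp (-t ^ 2 / (2 * c)) ≤ Real.exp (-t ^ 2 / (2 * R)) := by
    intro hc0
    have hcpos : (0 : ℝ) < c := lt_of_le_of_ne c.2 (Ne.symm hc0)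
    apply Real.exp_le_exp.mpr
    rw [neg_div, neg_div, neg_le_neg_iff]
    gcongr
  -- If `c = 0`, division by zero makes the sub-Gaussian bound the trivial `1`; but then the form
  -- vanishes and the event is empty.
  by_cases hc0 : (c : ℝ) = 0
  · have hg : ∀ v, g v = 0 := by
      have : ∑ v, g v ^ 2 = 0 := hcv.symm.trans hc0
      intro v
      have := (Finset.sum_eq_zero_iff_of_nonneg fun v _ => sq_nonneg (g v)).mp this v
        (Finset.mem_univ v)
      exact pow_eq_zero_iff (two_ne_zero) |>.mp this
    have : {z : V → ℝ | t < |∑ v, g v * z v|} = ∅ := by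
      ext z
      simp [hg, ht]
    simp [this]
  · have hset : {z : V → ℝ | t < |∑ v, g v * z v|} ⊆
        {z | t ≤ ∑ v, X v z} ∪ {z | t ≤ (-fun z => ∑ v, X v z) z} := by
      intro z hz
      rw [Set.mem_ofPred_eq] at hz
      rcases lt_abs.mp hz with h | h
      · exact Or.inl h.le
      · exact Or.inr h.le
    calc P {z : V → ℝ | t < |∑ v, g v * z v|}
        ≤ P {z | t ≤ ∑ v, X v z} + P {z | t ≤ (-fun z => ∑ v, X v z) z} :=
          (measure_mono hset).trans (measure_union_le _ _)
      _ ≤ ENNReal.ofReal (Real.exp (-t ^ 2 / (2 * R)))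
          + ENNReal.ofReal (Real.exp (-t ^ 2 / (2 * R))) := by
          refine add_le_add ?_ ?_
          · rw [← ofReal_measureReal]
            exact ENNReal.ofReal_le_ofReal (hup.trans (hexp hc0))
          · rw [← ofReal_measureReal]
            exact ENNReal.ofReal_le_ofReal (hdown.trans (hexp hc0))
      _ = _ := by
          rw [← ENNReal.ofReal_add (by positivity) (by positivity), ← two_mul]

/-- The law `𝒩(0, σ² I)` is the law of `σ` times a standard Gaussian vector. -/
theorem gaussianNoise_eq_map (V : Type*) [Fintype V] (σ : ℝ) :
    gaussianNoise V σ = (gaussianNoise V 1).map fun z v => σ * z v := by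
  unfold gaussianNoise
  rw [Measure.pi_map_pi (f := fun _ x => σ * x) (fun _ => by fun_prop)]
  congr 1
  ext1 v
  rw [gaussianReal_map_const_mul]
  congr 1
  · simp
  · ext; simp [Real.coe_toNNReal _ (sq_nonneg σ)]

instance isProbabilityMeasure_gaussianNoise (V : Type*) [Fintype V] (σ : ℝ) :
    IsProbabilityMeasure (gaussianNoise V σ) := by
  unfold gaussianNoise; infer_instance

/-- Simultaneous control of finitely many linear forms in Gaussian noise, and of the sum of the
noise. -/
theorem gaussianNoise_good_event {V E : Type*} [Fintype V] [Fintype E] [Nonempty V]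
    {Ω : Type*} [MeasurableSpace Ω] {μ : Measure Ω} {noise : Ω → V → ℝ}
    (g : E → V → ℝ) {R δ σ M : ℝ} (hδ : 0 < δ) (hδ1 : δ < 1) (hσ : 0 ≤ σ)
    (hR0 : Nonempty E → 0 < R) (hR : ∀ e, ∑ v, g e v ^ 2 ≤ R) (hM1 : 1 ≤ M)
    (hM : (Fintype.card E : ℝ) ≤ M) (hnoise : HasLaw noise (gaussianNoise V σ) μ) :
    ENNReal.ofReal (1 - 2 * δ) ≤ μ
      {ω | |∑ v, noise ω v| ≤
          Real.sqrt (Fintype.card V) * (σ * Real.sqrt (2 * Real.log (2 / δ))) ∧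
        ∀ e, |∑ v, g e v * noise ω v| ≤ σ * Real.sqrt (2 * R * Real.log (2 * M / δ))} := by
  have hmeas : MeasurableSet {z : V → ℝ |
      |∑ v, z v| ≤ Real.sqrt (Fintype.card V) * (σ * Real.sqrt (2 * Real.log (2 / δ))) ∧
        ∀ e, |∑ v, g e v * z v| ≤ σ * Real.sqrt (2 * R * Real.log (2 * M / δ))} := by
    rw [Set.ofPred_and, Set.ofPred_forall]
    refine MeasurableSet.inter (measurableSet_le (by fun_prop) (by fun_prop)) ?_
    exact MeasurableSet.iInter fun e => measurableSet_le (by fun_prop) (by fun_prop)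
  rw [hnoise.measure_eq hmeas, gaussianNoise_eq_map V σ, Measure.map_apply (by fun_prop) hmeas]
  set P := gaussianNoise V 1
  set n : ℝ := (Fintype.card V : ℝ) with hn
  have hn0 : 0 < n := by rw [hn]; exact_mod_cast Fintype.card_pos
  -- The thresholds make the tail bounds exactly `δ` for the sum and `δ / M` for each of the at most
  -- `M` forms.
  set t₀ := Real.sqrt n * Real.sqrt (2 * Real.log (2 / δ)) with ht₀
  set t₁ := Real.sqrt (2 * R * Real.log (2 * M / δ)) with ht₁
  have hlog0 : 0 ≤ Real.log (2 / δ) := Real.log_nonneg (by rw [le_div_iff₀ hδ]; linarith)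
  have hlog1 : 0 ≤ Real.log (2 * M / δ) := Real.log_nonneg (by rw [le_div_iff₀ hδ]; linarith)
  have hA : P {z | t₀ < |∑ v, 1 * z v|} ≤ ENNReal.ofReal δ := by
    refine (measure_abs_sum_ge_le (R := n) (fun _ => 1) (by positivity) (by simp [hn])).trans
      (ENNReal.ofReal_le_ofReal (le_of_eq ?_))
    have : -t₀ ^ 2 / (2 * n) = -Real.log (2 / δ) := by
      rw [ht₀, mul_pow, Real.sq_sqrt hn0.le, Real.sq_sqrt (by positivity)]
      field_simp
    rw [this, Real.exp_neg, Real.exp_log (by positivity)]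
    field_simp
  have hB : ∀ e, P {z | t₁ < |∑ v, g e v * z v|} ≤ ENNReal.ofReal (δ / M) := by
    intro e
    have hR1 := hR0 ⟨e⟩
    refine (measure_abs_sum_ge_le (g e) (by positivity) (hR e)).trans
      (ENNReal.ofReal_le_ofReal (le_of_eq ?_))
    have : -t₁ ^ 2 / (2 * R) = -Real.log (2 * M / δ) := by
      rw [ht₁, Real.sq_sqrt (by positivity)]
      field_simp
    rw [this, Real.exp_neg, Real.exp_log (by positivity)]
    field_simp
  set bad := {z : V → ℝ | t₀ < |∑ v, 1 * z v|} ∪ ⋃ e, {z : V → ℝ | t₁ < |∑ v, g e v * z v|}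
  have hbad : P bad ≤ ENNReal.ofReal (2 * δ) := by
    calc P bad ≤ ENNReal.ofReal δ + ∑ e : E, ENNReal.ofReal (δ / M) :=
          (measure_union_le _ _).trans (add_le_add hA ((measure_iUnion_fintype_le _ _).trans
            (Finset.sum_le_sum fun e _ => hB e)))
      _ = ENNReal.ofReal (δ + Fintype.card E * (δ / M)) := by
          rw [← ENNReal.ofReal_sum_of_nonneg fun _ _ => by positivity,
            ← ENNReal.ofReal_add hδ.le (Finset.sum_nonneg fun _ _ => by positivity)]
          simp
      _ ≤ _ := by
          apply ENNReal.ofReal_le_ofReal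
          have : Fintype.card E * (δ / M) ≤ M * (δ / M) := by gcongr
          rw [mul_div_cancel₀ _ (by positivity)] at this
          linarith
  have hbadm : MeasurableSet bad := by
    refine MeasurableSet.union (measurableSet_lt (by fun_prop) (by fun_prop)) ?_
    exact MeasurableSet.iUnion fun e => measurableSet_lt (by fun_prop) (by fun_prop)
  calc ENNReal.ofReal (1 - 2 * δ) = 1 - ENNReal.ofReal (2 * δ) := by
        rw [ENNReal.ofReal_sub _ (by positivity), ENNReal.ofReal_one]
    _ ≤ 1 - P bad := tsub_le_tsub_left hbad _
    _ = P badᶜ := (prob_compl_eq_one_sub hbadm).symm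
    _ ≤ _ := by
        refine measure_mono fun z hz => ?_
        simp only [bad, Set.mem_compl_iff, Set.mem_union, Set.mem_iUnion, Set.mem_ofPred_eq, not_or,
          not_exists, not_lt, one_mul] at hz
        refine ⟨?_, fun e => ?_⟩
        · rw [← Finset.mul_sum, abs_mul, abs_of_nonneg hσ]
          calc _ ≤ σ * t₀ := by gcongr; exact hz.1
            _ = _ := by rw [ht₀]; ring
        · have : ∑ v, g e v * (σ * z v) = σ * ∑ v, g e v * z v := by
            rw [Finset.mul_sum]; exact Finset.sum_congr rfl fun v _ => by ring
          rw [this, abs_mul, abs_of_nonneg hσ]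
          gcongr
          exact hz.2 e

/-! ### Choice of constants and conclusion. -/

theorem card_gridEdge_le (d N : ℕ) : Fintype.card (GridEdge d N) ≤ d * N ^ d := by
  have h : Function.Injective fun e : GridEdge d N => (e.1, e.lower) := by
    rintro ⟨j, i⟩ ⟨j', i'⟩ h
    simp only [GridEdge.lower, Prod.mk.injEq] at h
    obtain ⟨rfl, h⟩ := h
    rw [Subtype.ext h]
  simpa using Fintype.card_le_of_injective _ h

theorem rateFactor_nonneg (d n : ℕ) : 0 ≤ rateFactor d n := by
  unfold rateFactor
  split_ifs
  · exact Real.log_natCast_nonneg n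
  · exact zero_le_one

theorem rateFactor_pos {d n : ℕ} (hn : 2 ≤ n) : 0 < rateFactor d n := by
  unfold rateFactor
  split_ifs
  · exact Real.log_pos (by exact_mod_cast hn)
  · exact zero_lt_one

set_option maxHeartbeats 1000000 in
theorem mainTheorem7 (d : ℕ) (hd : 2 ≤ d) :
    ∃ c C : ℝ, 0 < c ∧ 0 < C ∧
      ∀ (N n : ℕ), 1 ≤ N → n = N ^ d →
      ∀ (δ σ β : ℝ), 0 < δ → δ < 1 → 0 ≤ σ → 0 < β →
      ∀ fstar : EuclideanSpace ℝ (Fin d) → ℝ, IsPiecewiseConstant d β fstar →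
      ∀ {Ω : Type*} [MeasurableSpace Ω] (μ : Measure Ω) [IsProbabilityMeasure μ]
        (noise y : Ω → GridVertex d N → ℝ),
        HasLaw noise (gaussianNoise (GridVertex d N) σ) μ →
        (∀ ω i, y ω i = fstar (gridPoint i) + noise ω i) →
      ∀ fhat : Ω → EuclideanSpace ℝ (Fin d) → ℝ,
        (∀ ω, IsTVDenoiser (gridIncidence d N)
          (c * σ * Real.sqrt (rateFactor d n * Real.log (Real.exp 1 * n / δ)) / n)
          (y ω) (fun i => fhat ω (gridPoint i))) →
        ENNReal.ofReal (1 - 2 * δ) ≤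
          μ {ω | empiricalNormSq d N (fun x => fhat ω x - fstar x) ≤
            C * (σ ^ 2 * β / (n : ℝ) ^ (1 / (d : ℝ)) * rateFactor d n
                  * Real.log (Real.exp 1 * n / δ)
                + σ ^ 2 / n * Real.log (Real.exp 1 / δ))} := by
  have hd0 : (0 : ℝ) < d := by exact_mod_cast (by omega : 0 < d)
  have hd1 : (2 : ℝ) ≤ d := by exact_mod_cast hd
  have hlogd : 0 ≤ Real.log (2 * d) := Real.log_nonneg (by linarith)
  -- Since `Λ ≥ 1`, `log (2dn/δ) = log (2d) + log (n/δ) ≤ K * Λ`.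
  set K : ℝ := 1 + Real.log (2 * d) with hK
  set R₀ : ℝ := 4 * 3 ^ d with hR₀
  have hK0 : 0 < K := by linarith
  have hR₀0 : 0 < R₀ := by positivity
  -- Makes `n * lam` at least twice the threshold for the flow forms.
  set c : ℝ := 2 * Real.sqrt (2 * R₀ * K) with hc
  have hc0 : 0 < c := by positivity
  refine ⟨c, 16 + 32 * c ^ 2 * d ^ 2 * 5 ^ d, hc0, by positivity, ?_⟩
  intro N n hN hn δ σ β hδ hδ1 hσ hβ fstar hf Ω _ μ _ noise y hnoise hy fhat hfhat
  have hN0 : (0 : ℝ) < N := by exact_mod_cast hN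
  have hnR : (n : ℝ) = (N : ℝ) ^ d := by rw [hn]; push_cast; rfl
  have hn0 : (0 : ℝ) < n := by rw [hnR]; positivity
  have hn1 : (1 : ℝ) ≤ n := by rw [hnR]; exact one_le_pow₀ (by exact_mod_cast hN)
  set r := rateFactor d n with hr
  have hr0 : 0 ≤ r := rateFactor_nonneg d n
  set Λ := Real.log (Real.exp 1 * n / δ) with hΛ
  have hΛ_eq : Λ = 1 + Real.log (n / δ) := by
    rw [hΛ, mul_div_assoc, Real.log_mul (by positivity) (by positivity), Real.log_exp]
  have hlognδ : 0 ≤ Real.log (n / δ) := Real.log_nonneg (by rw [le_div_iff₀ hδ]; linarith)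
  have hΛ0 : 0 ≤ Λ := by linarith
  have hlogM : Real.log (2 * (d * n) / δ) ≤ K * Λ := by
    have h1 : (2 * (d * n) / δ : ℝ) = (2 * d) * (n / δ) := by ring
    rw [h1, Real.log_mul (by positivity) (by positivity), hΛ_eq, hK]
    nlinarith
  set lam := c * σ * Real.sqrt (r * Λ) / n with hlam
  have hnlam : (N : ℝ) ^ d * lam = c * σ * Real.sqrt (r * Λ) := by
    rw [hlam, ← hnR]; field_simp
  set a := σ * Real.sqrt (2 * Real.log (2 / δ)) with ha
  have hlog2 : 0 ≤ Real.log (2 / δ) := Real.log_nonneg (by rw [le_div_iff₀ hδ]; linarith)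
  have ha2 : a ^ 2 ≤ 2 * σ ^ 2 * Real.log (Real.exp 1 / δ) := by
    have h1 : Real.log (2 / δ) ≤ Real.log (Real.exp 1 / δ) := by
      apply Real.log_le_log (by positivity)
      have := Real.exp_one_gt_d9
      gcongr
      linarith
    rw [ha, mul_pow, Real.sq_sqrt (by positivity)]
    nlinarith [sq_nonneg σ]
  have : Nonempty (GridVertex d N) := ⟨fun _ => ⟨0, hN⟩⟩
  have good := gaussianNoise_good_event (μ := μ) (noise := noise)
    (fun (e : GridEdge d N) v => gridFlow e v) (R := R₀ * r) (M := d * n) hδ hδ1 hσ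
    -- For `N = 1` and `d = 2` the rate factor is `0`, but then there are no edges.
    (by
      rintro ⟨e⟩
      have hN2 : 2 ≤ N := by have := e.2.2; omega
      have : 2 ≤ n := by rw [hn]; exact hN2.trans (Nat.le_self_pow (by omega) N)
      exact mul_pos hR₀0 (rateFactor_pos this))
    (by
      intro e
      rw [hR₀, hr, hn]
      exact sum_sq_gridFlow_le hd e)
    (by nlinarith)
    (by
      rw [hnR]
      exact_mod_cast card_gridEdge_le d N)
    hnoise
  -- The good event depends on the noise alone; monotonicity of the outer measure needs no
  -- measurability of `fhat`.
  refine good.trans (measure_mono fun ω hω => ?_)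
  rw [Set.mem_ofPred_eq] at hω ⊢
  obtain ⟨hmean, hflow⟩ := hω
  have hcard : (Fintype.card (GridVertex d N) : ℝ) = (N : ℝ) ^ d := by simp
  set S := Finset.univ.filter fun e : GridEdge d N =>
      fstar (gridPoint e.upper) ≠ fstar (gridPoint e.lower) with hSdef
  have hS := card_jump_edges_le hN hβ hf
  rw [← hSdef] at hS
  have oracle := sum_sq_sub_le_of_isTVDenoiser hN (lam := lam) (a := a) (by positivity)
    (by positivity) (θ₀ := fun i => fstar (gridPoint i)) (hy ω) (hfhat ω) S
    (by
      intro e he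
      rw [gridIncidence_mulVec]
      simpa [S, sub_eq_zero] using he)
    (hcard ▸ hmean)
    (by
      intro e
      rw [hnlam]
      calc _ ≤ 2 * (σ * Real.sqrt (2 * (R₀ * r) * Real.log (2 * (d * n) / δ))) := by
            gcongr; exact hflow e
        _ ≤ 2 * (σ * Real.sqrt ((2 * R₀ * K) * (r * Λ))) := by
            gcongr 2 * (σ * Real.sqrt ?_)
            calc _ ≤ 2 * (R₀ * r) * (K * Λ) := by gcongr
              _ = _ := by ring
        _ = _ := by rw [Real.sqrt_mul (by positivity), hc]; ring)
  have hsq : (c * σ * Real.sqrt (r * Λ)) ^ 2 = (c * σ) ^ 2 * (r * Λ) := by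
    rw [mul_pow (c * σ), Real.sq_sqrt (by positivity)]
  rw [hnlam, hsq] at oracle
  have hroot : (n : ℝ) ^ (1 / (d : ℝ)) = N := by
    rw [hnR, one_div, Real.pow_rpow_inv_natCast hN0.le (by omega)]
  have hpow : (N : ℝ) ^ (d - 1) / n = 1 / N := by
    rw [hnR, div_eq_div_iff (by positivity) (by positivity), one_mul, ← pow_succ,
      Nat.sub_add_cancel (by omega)]
  rw [hroot]
  unfold empiricalNormSq
  rw [← hnR]
  set Λ' := Real.log (Real.exp 1 / δ)
  have hΛ'0 : 0 ≤ Λ' := Real.log_nonneg (by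
    rw [le_div_iff₀ hδ]
    have := Real.exp_one_gt_d9
    linarith)
  have hA : 0 ≤ σ ^ 2 * β / N * r * Λ := by positivity
  have hB : 0 ≤ σ ^ 2 / n * Λ' := by positivity
  calc _ ≤ (1 / (n : ℝ)) * (8 * (2 * σ ^ 2 * Λ')
        + 32 * ((c * σ) ^ 2 * (r * Λ)) * d * (d * 5 ^ d * (β * (N : ℝ) ^ (d - 1)))) := by
        refine mul_le_mul_of_nonneg_left (oracle.trans (add_le_add ?_ ?_)) (by positivity)
        · exact mul_le_mul_of_nonneg_left ha2 (by norm_num)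
        · exact mul_le_mul_of_nonneg_left hS (by positivity)
    _ = 16 * (σ ^ 2 / n * Λ') + 32 * c ^ 2 * d ^ 2 * 5 ^ d *
          (σ ^ 2 * β * ((N : ℝ) ^ (d - 1) / n) * r * Λ) := by ring
    _ = 16 * (σ ^ 2 / n * Λ') + 32 * c ^ 2 * d ^ 2 * 5 ^ d * (σ ^ 2 * β / N * r * Λ) := by
        rw [hpow]; ring
    _ ≤ _ := by
        have hE : 0 ≤ 32 * c ^ 2 * (d : ℝ) ^ 2 * 5 ^ d := by positivity
        nlinarith [mul_nonneg hE hB]
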